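/- For an abelian group $H$, the generalized dihedral group over $H$ is the semidirect product of $H$ with the cyclic group of order two whose non-identity element acts on $H$ by $h\mapsto h^{-1}$. A finite digraph with non-empty vertex set is oriented if it has no loops and no digons (no two arcs $(x,y)$ and $(y,x)$), and regular if all in-valencies and all out-valencies of its vertices equal one common number. For a positive integer $m$, a finite group $G$ admits an oriented $m$-semiregular representation (O$m$SR) if there is a finite regular oriented digraph $\Gamma$ that has a group of automorphisms isomorphic to $G$ which is semiregular on the vertices (all vertex stabilizers are trivial) with exactly $m$ orbits, and whose full automorphism group satisfies $\mathrm{Aut}(\Gamma)\cong G$. **Lemma.** Let $G$ be a finite non-abelian group that is (isomorphic to) a generalized dihedral group over some abelian group. Then $G$ admits an O$m$SR for every integer $m\ge 2$. -/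

import Mathlib

universe u

/-- The cyclic group of order two acting on an abelian group `H`, its non-identity element acting
as the inverse map `h ↦ h⁻¹`. -/
def inversionAction (H : Type u) [CommGroup H] : Multiplicative (ZMod 2) →* MulAut H where
  toFun c := if c = 1 then 1 else MulEquiv.inv H
  map_one' := if_pos rfl
  map_mul' := by
    have key : ∀ c d : Multiplicative (ZMod 2),
        (c = 1 ∧ c * d = d) ∨ (d = 1 ∧ c * d = c) ∨ (c ≠ 1 ∧ d ≠ 1 ∧ c * d = 1) := by decide
    intro c d
    rcases key c d with ⟨hc, h⟩ | ⟨hd, h⟩ | ⟨hc, hd, h⟩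
    · rw [h, if_pos hc, one_mul]
    · rw [h, if_pos hd, mul_one]
    · rw [h, if_pos rfl, if_neg hc, if_neg hd]
      ext x
      simp

/-- The generalized dihedral group over the abelian group `H`. -/
abbrev GeneralizedDihedral (H : Type u) [CommGroup H] : Type u :=
  H ⋊[inversionAction H] Multiplicative (ZMod 2)

/-- `G` is (isomorphic to) the generalized dihedral group over some abelian group. -/
def IsGeneralizedDihedral (G : Type u) [Group G] : Prop :=
  ∃ (H : Type u) (_ : CommGroup H), Nonempty (G ≃* GeneralizedDihedral H)

/-- The full automorphism group of a digraph, as a group of permutations of its vertices. -/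
def digraphAut {V : Type u} (Γ : Digraph V) : Subgroup (Equiv.Perm V) where
  carrier := {σ | ∀ x y, Γ.Adj (σ x) (σ y) ↔ Γ.Adj x y}
  mul_mem' := by
    intro σ τ hσ hτ x y
    exact (hσ (τ x) (τ y)).trans (hτ x y)
  one_mem' := fun _ _ => Iff.rfl
  inv_mem' := by
    intro σ hσ x y
    have h := hσ (σ⁻¹ x) (σ⁻¹ y)
    rw [← Equiv.Perm.mul_apply, ← Equiv.Perm.mul_apply, mul_inv_cancel] at h
    exact h.symm

/-- All vertices have the same in-valency and out-valency, one common number `k`. -/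
def IsRegularDigraph {V : Type u} (Γ : Digraph V) : Prop :=
  ∃ k : ℕ, ∀ v : V, {w | Γ.Adj v w}.ncard = k ∧ {w | Γ.Adj w v}.ncard = k

/-- No digons; the case `x = y` says that there are no loops. -/
def IsOrientedDigraph {V : Type u} (Γ : Digraph V) : Prop :=
  ∀ x y : V, Γ.Adj x y → ¬ Γ.Adj y x

/-- A permutation group in which all point stabilizers are trivial. -/
def IsSemiregularPermGroup {V : Type u} (K : Subgroup (Equiv.Perm V)) : Prop :=
  ∀ v : V, MulAction.stabilizer K v = ⊥

/-- `Γ` has a semiregular group of automorphisms isomorphic to `G` with `m` orbits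
on the vertices. -/
def IsCayleyDigraph (m : ℕ) (G : Type u) [Group G] {V : Type u} (Γ : Digraph V) : Prop :=
  ∃ K : Subgroup (Equiv.Perm V), K ≤ digraphAut Γ ∧ Nonempty (G ≃* K) ∧
    IsSemiregularPermGroup K ∧ Nat.card (MulAction.orbitRel.Quotient K V) = m

/-- `G` admits an oriented `m`-semiregular representation: there is a finite regular oriented
`m`-Cayley digraph of `G` whose full automorphism group is isomorphic to `G`. -/
def AdmitsOmSR (m : ℕ) (G : Type u) [Group G] : Prop :=
  ∃ (V : Type u) (_ : Finite V) (_ : Nonempty V) (Γ : Digraph V),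
    IsRegularDigraph Γ ∧ IsOrientedDigraph Γ ∧ IsCayleyDigraph m G Γ ∧
      Nonempty (G ≃* digraphAut Γ)

/-! Non-commutativity forces some `h : H` with `h * h ≠ 1`, so `H` has an irredundant generating
family `x 0, …, x (r - 1)` of elements with non-trivial square. Take `m` layers, each made of two
copies of `H` (half-layers, one per coset). Each half-layer carries the Cayley digraph of the
generators, and all pairs between distinct layers are oriented. Towards each other layer a vertex
sends `r` sparse arcs, given by the partial products `x 1 * ⋯ * x k`, into one half-layer; the pairs
left over are oriented so that it sends `Nat.card H - r` dense arcs into the other. The group acts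
by `layeredPerm`, regularly on each layer.

There is no further symmetry. Non-adjacency recovers the layers, connectedness the half-layers, and
`2 * r < Nat.card H` the sparse arcs (`sparseArc_iff`). As `x 0` is left out of the products, sparse
arcs within a coset differ from those across cosets (`isTransportable_iff`); this fixes the order of
the layers. Sparse out-neighbours in a half-layer induce a directed path, which is rigid. Hence an
automorphism fixing a vertex translates each half-layer, and the translations are trivial
(`eq_one_of_apply_eq_self`). -/

/-! ### Irredundant generators and their partial products -/

section IrredundantGenerators

open Subgroup

/-- The elements `x 0, …, x (r - 1)` are non-involutions forming an irredundant generating family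
of `H`. -/
structure IsIrredundant {H : Type*} [CommGroup H] (r : ℕ) (x : ℕ → H) : Prop where
  pos : 0 < r
  sq : ∀ k < r, x k * x k ≠ 1
  gen : closure (x '' Set.Iio r) = ⊤
  irred : ∀ k < r, x k ∉ closure (x '' (Set.Iio r \ {k}))

/-- The product `x 1 * ⋯ * x k`. -/
def tailProd {H : Type*} [CommGroup H] (x : ℕ → H) : ℕ → H
  | 0 => 1
  | k + 1 => tailProd x k * x (k + 1)

/-- If `t * t = 1`, then `t * a` has the same square as `a`, and `t = (t * a) * a⁻¹`. -/
theorem closure_noninvolutions_eq_top {H : Type*} [CommGroup H] {a : H} (ha : a * a ≠ 1) :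
    closure {h : H | h * h ≠ 1} = ⊤ := by
  rw [eq_top_iff]
  intro t _
  by_cases ht : t * t = 1
  · have h1 : t * a ∈ closure {h : H | h * h ≠ 1} := subset_closure (by
      change t * a * (t * a) ≠ 1
      rwa [mul_mul_mul_comm, ht, one_mul])
    simpa using mul_mem h1 (inv_mem (subset_closure ha))
  · exact subset_closure ht

/-- Enumerate an inclusion-minimal generating set of elements with non-trivial square. -/
theorem exists_isIrredundant {H : Type*} [CommGroup H] [Finite H] {a : H} (ha : a * a ≠ 1) :
    ∃ (r : ℕ) (x : ℕ → H), IsIrredundant r x := by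
  classical
  have hfin : {S : Set H | closure S = ⊤ ∧ ∀ h ∈ S, h * h ≠ 1}.Finite := Set.toFinite _
  obtain ⟨S, hS⟩ := hfin.exists_minimal
    ⟨{h : H | h * h ≠ 1}, closure_noninvolutions_eq_top ha, fun h hh => hh⟩
  obtain ⟨⟨hgen, hsq⟩, hmin⟩ := hS
  obtain ⟨r, ⟨φ⟩⟩ := Finite.exists_equiv_fin S
  let x : ℕ → H := fun k => if hk : k < r then (φ.symm ⟨k, hk⟩ : H) else 1
  have hx : ∀ k (hk : k < r), x k = φ.symm ⟨k, hk⟩ := fun k hk => dif_pos hk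
  have himg : x '' Set.Iio r = S := by
    ext h
    constructor
    · rintro ⟨k, hk, rfl⟩
      rw [hx k hk]
      exact Subtype.coe_prop _
    · intro hh
      refine ⟨φ ⟨h, hh⟩, (φ ⟨h, hh⟩).2, ?_⟩
      rw [hx _ (φ ⟨h, hh⟩).2]
      simp
  refine ⟨r, x, ?_, ?_, by rw [himg, hgen], ?_⟩
  · rcases Nat.eq_zero_or_pos r with rfl | h
    · exfalso
      have hS0 : S = ∅ := by rw [← himg]; ext; simp
      rw [hS0, Subgroup.closure_empty] at hgen
      have : a ∈ (⊥ : Subgroup H) := hgen ▸ mem_top a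
      rw [mem_bot] at this
      exact ha (by simp [this])
    · exact h
  · intro k hk
    exact hsq _ (himg ▸ ⟨k, hk, rfl⟩)
  · intro k hk hmem
    have hsub : x '' (Set.Iio r \ {k}) ⊆ S := by
      rw [← himg]; exact Set.image_mono Set.sdiff_subset
    have hle : S ≤ x '' (Set.Iio r \ {k}) := by
      refine hmin ⟨?_, fun h hh => hsq h (hsub hh)⟩ hsub
      rw [eq_top_iff, ← hgen, closure_le, ← himg]
      rintro _ ⟨l, hl, rfl⟩
      by_cases hlk : l = k
      · exact hlk ▸ hmem
      · exact subset_closure ⟨l, ⟨hl, hlk⟩, rfl⟩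
    obtain ⟨l, ⟨hl, hlk⟩, he⟩ := hle (himg ▸ ⟨k, hk, rfl⟩ : x k ∈ S)
    rw [hx k hk, hx l hl] at he
    have := φ.symm.injective (Subtype.ext he)
    exact hlk (Fin.mk.inj this)

namespace IsIrredundant

variable {H : Type*} [CommGroup H] {r : ℕ} {x : ℕ → H}

theorem mem_others {j k : ℕ} (hj : j < r) (hjk : j ≠ k) :
    x j ∈ closure (x '' (Set.Iio r \ {k})) :=
  subset_closure ⟨j, ⟨hj, hjk⟩, rfl⟩

/-- The product involves only `x 1, …, x l`, so it always avoids `x 0`. -/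
theorem tailProd_mem {k l : ℕ} (hl : l < r) (h : l < k ∨ k = 0) :
    tailProd x l ∈ closure (x '' (Set.Iio r \ {k})) := by
  induction l with
  | zero => exact one_mem _
  | succ l ih => exact mul_mem (ih (by omega) (by omega)) (mem_others hl (by omega))

/-- A generator is not a product of an element avoiding it and other generators. -/
theorem ne_of_mem (hx : IsIrredundant r x) {k : ℕ} (hk : k < r) {g : H}
    (hg : g ∈ closure (x '' (Set.Iio r \ {k}))) : x k ≠ g :=
  fun h => hx.irred k hk (h ▸ hg)

theorem mul_ne_one (hx : IsIrredundant r x) {j k : ℕ} (hj : j < r) (hk : k < r) :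
    x j * x k ≠ 1 := by
  intro h
  by_cases hjk : j = k
  · exact hx.sq k hk (hjk ▸ h)
  · exact hx.ne_of_mem hk (inv_mem (mem_others hj hjk)) (eq_inv_of_mul_eq_one_right h)

theorem ne_one (hx : IsIrredundant r x) {k : ℕ} (hk : k < r) : x k ≠ 1 :=
  hx.ne_of_mem hk (one_mem _)

theorem injOn (hx : IsIrredundant r x) : Set.InjOn x (Set.Iio r) := by
  intro j hj k hk h
  by_contra hjk
  exact hx.ne_of_mem hk (mem_others hj hjk) h.symm

theorem tailProd_ne (hx : IsIrredundant r x) {k l : ℕ} (hkl : k < l) (hl : l < r) :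
    tailProd x k ≠ tailProd x l := by
  obtain ⟨l, rfl⟩ := Nat.exists_eq_add_one_of_ne_zero (Nat.ne_zero_of_lt hkl)
  intro h
  refine hx.ne_of_mem hl (mul_mem (inv_mem (tailProd_mem (l := l) (by omega) (by omega)))
    (tailProd_mem (l := k) (by omega) (by omega))) ?_
  rw [h, tailProd, inv_mul_cancel_left]

theorem injOn_tailProd (hx : IsIrredundant r x) : Set.InjOn (tailProd x) (Set.Iio r) := by
  intro j hj k hk h
  by_contra hjk
  rcases Nat.lt_or_gt_of_ne hjk with h1 | h1
  · exact hx.tailProd_ne h1 hk h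
  · exact hx.tailProd_ne h1 hj h.symm

/-- The partial products induce a directed path in the Cayley digraph of the generators. -/
theorem eq_succ_of_tailProd_mul (hx : IsIrredundant r x) {j k l : ℕ} (hj : j < r) (hk : k < r)
    (hl : l < r) (h : tailProd x k * x j = tailProd x l) : l = k + 1 := by
  rcases lt_trichotomy k l with hkl | rfl | hlk
  · obtain ⟨l, rfl⟩ := Nat.exists_eq_add_one_of_ne_zero (Nat.ne_zero_of_lt hkl)
    by_cases hjl : j = l + 1
    · subst hjl
      rw [tailProd, mul_left_inj] at h
      have hl' : l ∈ Set.Iio r := Set.mem_Iio.2 (by omega)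
      have := hx.injOn_tailProd (Set.mem_Iio.2 hk) hl' h
      omega
    · by_contra hne
      refine hx.ne_of_mem hl (mul_mem (inv_mem (tailProd_mem (l := l) (by omega) (by omega)))
        (mul_mem (tailProd_mem (l := k) (by omega) (by omega)) (mem_others hj hjl))) ?_
      rw [h, tailProd, inv_mul_cancel_left]
  · exact absurd (by simpa using h) (hx.ne_one hj)
  · exfalso
    obtain ⟨k, rfl⟩ := Nat.exists_eq_add_one_of_ne_zero (Nat.ne_zero_of_lt hlk)
    by_cases hjk : j = k + 1
    · subst hjk
      rcases Nat.eq_or_lt_of_le (Nat.le_of_lt_succ hlk) with rfl | hlt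
      · rw [tailProd, mul_assoc] at h
        exact hx.sq _ hj (by simpa using h)
      · obtain ⟨k, rfl⟩ := Nat.exists_eq_add_one_of_ne_zero (Nat.ne_zero_of_lt hlt)
        -- The square of `x (k + 2)` may lie in the span of the other generators, so `x (k + 1)` is
        -- isolated instead.
        have hm : x (k + 2) ∈ closure (x '' (Set.Iio r \ {k + 1})) :=
          mem_others hk (by omega)
        refine hx.ne_of_mem (k := k + 1) (by omega)
          (mul_mem (inv_mem (mul_mem (tailProd_mem (l := k) (by omega) (by omega))
            (mul_mem hm hm))) (tailProd_mem (l := l) (by omega) (by omega))) ?_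
        rw [← h, tailProd, tailProd, eq_inv_mul_iff_mul_eq]
        simp only [mul_comm, mul_left_comm]
    · refine hx.ne_of_mem hk (mul_mem (inv_mem (mul_mem (tailProd_mem (l := k) (by omega)
        (by omega)) (mem_others hj hjk))) (tailProd_mem (l := l) (by omega) (by omega))) ?_
      rw [← h, tailProd, eq_inv_mul_iff_mul_eq]
      exact mul_right_comm _ _ _

/-- This is why the products start at `x 1`: cancelling or isolating the last factor always
contradicts irredundancy. It separates the two kinds of sparse arcs. -/
theorem mul_ne_tailProd (hx : IsIrredundant r x) {j k : ℕ} (hj : j < r) (hk : k < r) :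
    x 0 * x j ≠ tailProd x k := by
  intro h
  rcases Nat.eq_zero_or_pos k with rfl | hpos
  · exact hx.mul_ne_one hx.pos hj h
  obtain ⟨k, rfl⟩ := Nat.exists_eq_add_one_of_ne_zero hpos.ne'
  by_cases hjk : j = k + 1
  · subst hjk
    rw [tailProd, mul_left_inj] at h
    exact hx.ne_of_mem hx.pos (tailProd_mem (l := k) (by omega) (Or.inr rfl)) h
  · refine hx.ne_of_mem hk (mul_mem (inv_mem (tailProd_mem (l := k) (by omega) (by omega)))
      (mul_mem (mem_others hx.pos (by omega)) (mem_others hj hjk))) ?_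
    rw [h, tailProd, inv_mul_cancel_left]

theorem ncard_image (hx : IsIrredundant r x) : (x '' Set.Iio r).ncard = r := by
  rw [hx.injOn.ncard_image]; simp [Set.ncard_eq_toFinset_card']

theorem ncard_image_tailProd (hx : IsIrredundant r x) :
    (tailProd x '' Set.Iio r).ncard = r := by
  rw [hx.injOn_tailProd.ncard_image]; simp [Set.ncard_eq_toFinset_card']

/-- The generators, their inverses and `1` are all distinct. -/
theorem two_mul_lt_card [Finite H] (hx : IsIrredundant r x) : 2 * r < Nat.card H := by
  set R := x '' Set.Iio r with hR
  have h1 : Disjoint R R⁻¹ := by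
    rw [Set.disjoint_left]
    rintro _ ⟨j, hj, rfl⟩ ⟨k, hk, h⟩
    exact hx.mul_ne_one hk hj (by rw [h, inv_mul_cancel])
  have h2 : (R ∪ R⁻¹).ncard = 2 * r := by
    rw [Set.ncard_union_eq h1, Set.ncard_inv, hx.ncard_image]; omega
  have h3 : (1 : H) ∉ R ∪ R⁻¹ := by
    rintro (⟨k, hk, h⟩ | ⟨k, hk, h⟩)
    · exact hx.ne_one hk h
    · exact hx.ne_one hk (by simpa using h)
  rw [← h2, ← Set.ncard_univ]
  exact Set.ncard_lt_ncard ⟨Set.subset_univ _, fun h => h3 (h (Set.mem_univ _))⟩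

end IsIrredundant

end IrredundantGenerators

/-! ### The layered digraph: orientation, regularity, sparse arcs -/

/-- A vertex of the layered digraph: an element of `H`, a coset of `H` in the generalized dihedral
group, and a layer. -/
abbrev LayeredVertex (H : Type u) (m : ℕ) : Type u :=
  H × Multiplicative (ZMod 2) × Fin m

/-- Arcs between distinct layers that follow the partial products. -/
def SparseArc {H : Type u} [CommGroup H] (r : ℕ) (x : ℕ → H) {m : ℕ}
    (v w : LayeredVertex H m) : Prop :=
  (v.2.1 = w.2.1 ∧ v.2.2 < w.2.2 ∧ v.1⁻¹ * w.1 ∈ tailProd x '' Set.Iio r) ∨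
    (v.2.1 ≠ w.2.1 ∧ w.2.2 < v.2.2 ∧ v.1 * w.1 ∈ tailProd x '' Set.Iio r)

/-- Within a half-layer the arcs are those of the Cayley digraph of the generators; two distinct
layers are completely joined. -/
def layeredDigraph {H : Type u} [CommGroup H] (r : ℕ) (x : ℕ → H) (m : ℕ) :
    Digraph (LayeredVertex H m) where
  Adj v w :=
    (v.2 = w.2 ∧ v.1⁻¹ * w.1 ∈ x '' Set.Iio r) ∨ SparseArc r x v w ∨
      (v.2.1 = w.2.1 ∧ w.2.2 < v.2.2 ∧ w.1⁻¹ * v.1 ∉ tailProd x '' Set.Iio r) ∨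
      (v.2.1 ≠ w.2.1 ∧ v.2.2 < w.2.2 ∧ w.1 * v.1 ∉ tailProd x '' Set.Iio r)

section Basic

variable {H : Type u} [CommGroup H] {r : ℕ} {x : ℕ → H} {m : ℕ}

theorem adj_of_snd_eq {k l : H} {q : Multiplicative (ZMod 2) × Fin m} :
    (layeredDigraph r x m).Adj (k, q) (l, q) ↔ k⁻¹ * l ∈ x '' Set.Iio r := by
  simp [layeredDigraph, SparseArc]

theorem adj_of_layer_eq {v w : LayeredVertex H m} (h : v.2.2 = w.2.2) :
    (layeredDigraph r x m).Adj v w ↔ v.2 = w.2 ∧ v.1⁻¹ * w.1 ∈ x '' Set.Iio r := by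
  simp [layeredDigraph, SparseArc, h]

theorem adj_eq_lt {k l : H} {e : Multiplicative (ZMod 2)} {i j : Fin m} (h : i < j) :
    (layeredDigraph r x m).Adj (k, e, i) (l, e, j) ↔ k⁻¹ * l ∈ tailProd x '' Set.Iio r := by
  simp [layeredDigraph, SparseArc, h, h.ne, h.not_gt]

theorem adj_eq_gt {k l : H} {e : Multiplicative (ZMod 2)} {i j : Fin m} (h : j < i) :
    (layeredDigraph r x m).Adj (k, e, i) (l, e, j) ↔ l⁻¹ * k ∉ tailProd x '' Set.Iio r := by
  simp [layeredDigraph, SparseArc, h, h.ne', h.not_gt]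

theorem adj_ne_gt {k l : H} {e f : Multiplicative (ZMod 2)} {i j : Fin m} (hef : e ≠ f)
    (h : j < i) :
    (layeredDigraph r x m).Adj (k, e, i) (l, f, j) ↔ k * l ∈ tailProd x '' Set.Iio r := by
  simp [layeredDigraph, SparseArc, h, h.not_gt, hef]

theorem adj_ne_lt {k l : H} {e f : Multiplicative (ZMod 2)} {i j : Fin m} (hef : e ≠ f)
    (h : i < j) :
    (layeredDigraph r x m).Adj (k, e, i) (l, f, j) ↔ l * k ∉ tailProd x '' Set.Iio r := by
  simp [layeredDigraph, SparseArc, h, h.not_gt, hef]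

theorem layeredDigraph_adj_iff_not_adj {v w : LayeredVertex H m} (h : v.2.2 ≠ w.2.2) :
    (layeredDigraph r x m).Adj v w ↔ ¬ (layeredDigraph r x m).Adj w v := by
  obtain ⟨k, e, i⟩ := v
  obtain ⟨l, f, j⟩ := w
  rcases lt_or_gt_of_ne h with h | h <;> by_cases hef : e = f
  · subst hef
    rw [adj_eq_lt h, adj_eq_gt h, not_not]
  · rw [adj_ne_lt hef h, adj_ne_gt (Ne.symm hef) h]
  · subst hef
    rw [adj_eq_lt h, adj_eq_gt h]
  · rw [adj_ne_lt (Ne.symm hef) h, adj_ne_gt hef h, not_not]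

theorem isOriented_layeredDigraph (hx : IsIrredundant r x) :
    IsOrientedDigraph (layeredDigraph r x m) := by
  intro v w hvw
  by_cases h : v.2.2 = w.2.2
  · rw [adj_of_layer_eq h] at hvw
    rw [adj_of_layer_eq h.symm]
    rintro ⟨-, k, hk, hk'⟩
    obtain ⟨-, j, hj, hj'⟩ := hvw
    exact hx.mul_ne_one hj hk (by rw [hj', hk']; group)
  · exact (layeredDigraph_adj_iff_not_adj h).1 hvw

theorem ncard_setOf_equiv_mem {α : Type*} (e : α ≃ α) (S : Set α) :
    {a | e a ∈ S}.ncard = S.ncard := by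
  change (e ⁻¹' S).ncard = S.ncard
  rw [← Set.ncard_image_of_injective _ e.injective, Set.image_preimage_eq _ e.surjective]

theorem ncard_setOf_equiv_notMem {α : Type*} [Finite α] (e : α ≃ α) (S : Set α) :
    {a | e a ∉ S}.ncard = Nat.card α - S.ncard := by
  rw [← Set.ncard_compl]
  exact ncard_setOf_equiv_mem e Sᶜ

theorem ncard_adj_eq (hx : IsIrredundant r x) (k : H) (q : Multiplicative (ZMod 2) × Fin m) :
    {l | (layeredDigraph r x m).Adj (k, q) (l, q)}.ncard = r ∧
      {l | (layeredDigraph r x m).Adj (l, q) (k, q)}.ncard = r := by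
  simp only [adj_of_snd_eq]
  constructor
  · exact (ncard_setOf_equiv_mem (Equiv.mulLeft k⁻¹) _).trans hx.ncard_image
  · exact (ncard_setOf_equiv_mem ((Equiv.inv H).trans (Equiv.mulRight k)) _).trans hx.ncard_image

variable [Finite H]

theorem ncard_adj_eq_lt (hx : IsIrredundant r x) (k : H) {e : Multiplicative (ZMod 2)}
    {i j : Fin m} (h : i < j) :
    {l | (layeredDigraph r x m).Adj (k, e, i) (l, e, j)}.ncard = r ∧
      {l | (layeredDigraph r x m).Adj (l, e, j) (k, e, i)}.ncard = Nat.card H - r := by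
  simp only [adj_eq_lt h, adj_eq_gt h]
  constructor
  · exact (ncard_setOf_equiv_mem (Equiv.mulLeft k⁻¹) _).trans hx.ncard_image_tailProd
  · exact (ncard_setOf_equiv_notMem (Equiv.mulLeft k⁻¹) _).trans
      (congrArg _ hx.ncard_image_tailProd)

theorem ncard_adj_eq_gt (hx : IsIrredundant r x) (k : H) {e : Multiplicative (ZMod 2)}
    {i j : Fin m} (h : j < i) :
    {l | (layeredDigraph r x m).Adj (k, e, i) (l, e, j)}.ncard = Nat.card H - r ∧
      {l | (layeredDigraph r x m).Adj (l, e, j) (k, e, i)}.ncard = r := by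
  simp only [adj_eq_lt h, adj_eq_gt h]
  constructor
  · exact (ncard_setOf_equiv_notMem ((Equiv.inv H).trans (Equiv.mulRight k)) _).trans
      (congrArg _ hx.ncard_image_tailProd)
  · exact (ncard_setOf_equiv_mem ((Equiv.inv H).trans (Equiv.mulRight k)) _).trans
      hx.ncard_image_tailProd

theorem ncard_adj_ne_gt (hx : IsIrredundant r x) (k : H) {e f : Multiplicative (ZMod 2)}
    {i j : Fin m} (hef : e ≠ f) (h : j < i) :
    {l | (layeredDigraph r x m).Adj (k, e, i) (l, f, j)}.ncard = r ∧
      {l | (layeredDigraph r x m).Adj (l, f, j) (k, e, i)}.ncard = Nat.card H - r := by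
  simp only [adj_ne_gt hef h, adj_ne_lt hef.symm h]
  constructor
  · exact (ncard_setOf_equiv_mem (Equiv.mulLeft k) _).trans hx.ncard_image_tailProd
  · exact (ncard_setOf_equiv_notMem (Equiv.mulLeft k) _).trans (congrArg _ hx.ncard_image_tailProd)

theorem ncard_adj_ne_lt (hx : IsIrredundant r x) (k : H) {e f : Multiplicative (ZMod 2)}
    {i j : Fin m} (hef : e ≠ f) (h : i < j) :
    {l | (layeredDigraph r x m).Adj (k, e, i) (l, f, j)}.ncard = Nat.card H - r ∧
      {l | (layeredDigraph r x m).Adj (l, f, j) (k, e, i)}.ncard = r := by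
  simp only [adj_ne_gt hef.symm h, adj_ne_lt hef h]
  constructor
  · exact (ncard_setOf_equiv_notMem (Equiv.mulRight k) _).trans (congrArg _ hx.ncard_image_tailProd)
  · exact (ncard_setOf_equiv_mem (Equiv.mulRight k) _).trans hx.ncard_image_tailProd

theorem ncard_layeredVertex {A : Type u} [Finite A] {m : ℕ} (D : LayeredVertex A m → Prop) :
    {v | D v}.ncard = ∑ j : Fin m, ∑ f : Multiplicative (ZMod 2), {l | D (l, f, j)}.ncard := by
  classical
  have := Fintype.ofFinite A
  simp only [← Nat.card_coe_set_eq, Set.coe_ofPred]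
  rw [← Fintype.sum_prod_type_right (f := fun q => Nat.card {l // D (l, q)}), ← Nat.card_sigma]
  exact Nat.card_congr
    { toFun := fun v => ⟨v.1.2, v.1.1, v.2⟩
      invFun := fun v => ⟨(v.2.1, v.1), v.2.2⟩
      left_inv := fun _ => rfl
      right_inv := fun _ => rfl }

theorem sum_zmod_two (g : Multiplicative (ZMod 2) → ℕ) {e f : Multiplicative (ZMod 2)}
    (h : e ≠ f) : ∑ c, g c = g e + g f := by
  have key : ∀ a b c : Multiplicative (ZMod 2), a ≠ b → c = a ∨ c = b := by decide
  rw [← Finset.sum_pair h]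
  refine (Finset.sum_subset (Finset.subset_univ _) fun c _ hc => ?_).symm
  simp only [Finset.mem_insert, Finset.mem_singleton] at hc
  exact absurd (key e f c h) hc

/-- In each direction, the two halves of another layer contribute `r` and `Nat.card H - r`, and the
own layer contributes `r`. -/
theorem isRegular_layeredDigraph (hx : IsIrredundant r x) :
    IsRegularDigraph (layeredDigraph r x m) := by
  have hn := hx.two_mul_lt_card
  have hne : ∀ e : Multiplicative (ZMod 2), ∃ f, e ≠ f := by decide
  have hsum : ∀ i : Fin m, ∑ j : Fin m, (if j = i then r else Nat.card H) =
      r + (m - 1) * Nat.card H := by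
    intro i
    rw [← Finset.add_sum_erase _ _ (Finset.mem_univ i), if_pos rfl,
      Finset.sum_congr rfl fun j hj => if_neg (Finset.ne_of_mem_erase hj)]
    simp
  refine ⟨r + (m - 1) * Nat.card H, ?_⟩
  rintro ⟨k, e, i⟩
  obtain ⟨f, hef⟩ := hne e
  rw [ncard_layeredVertex, ncard_layeredVertex]
  constructor
  all_goals
    rw [← hsum i]
    refine Finset.sum_congr rfl fun j _ => ?_
    rw [sum_zmod_two _ hef]
    rcases lt_trichotomy i j with h | rfl | h
  · rw [(ncard_adj_eq_lt hx k h).1, (ncard_adj_ne_lt hx k hef h).1, if_neg h.ne']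
    omega
  · rw [(ncard_adj_eq hx k _).1, if_pos rfl]
    simp [layeredDigraph, SparseArc, hef]
  · rw [(ncard_adj_eq_gt hx k h).1, (ncard_adj_ne_gt hx k hef h).1, if_neg h.ne]
    omega
  · rw [(ncard_adj_eq_lt hx k h).2, (ncard_adj_ne_lt hx k hef h).2, if_neg h.ne']
    omega
  · rw [(ncard_adj_eq hx k _).2, if_pos rfl]
    simp [layeredDigraph, SparseArc, hef.symm]
  · rw [(ncard_adj_eq_gt hx k h).2, (ncard_adj_ne_gt hx k hef h).2, if_neg h.ne]
    omega

/-- Sparse arcs are recognised by their number inside a half-layer. -/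
theorem sparseArc_iff (hx : IsIrredundant r x) {v w : LayeredVertex H m} :
    SparseArc r x v w ↔ v.2.2 ≠ w.2.2 ∧ (layeredDigraph r x m).Adj v w ∧
      {z | (layeredDigraph r x m).Adj v z ∧ z.2 = w.2}.ncard = r := by
  -- This makes the dense count `Nat.card H - r` different from `r`.
  have hn := hx.two_mul_lt_card
  have hcount : {z | (layeredDigraph r x m).Adj v z ∧ z.2 = w.2}.ncard =
      {l | (layeredDigraph r x m).Adj v (l, w.2)}.ncard := by
    rw [← Set.ncard_image_of_injective (f := fun l : H => ((l, w.2) : LayeredVertex H m)) _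
      (fun a b h => (Prod.mk.inj h).1)]
    congr 1
    ext ⟨l, q⟩
    simp only [Set.mem_ofPred_eq, Set.mem_image, Prod.mk.injEq]
    constructor
    · rintro ⟨h, rfl⟩
      exact ⟨l, h, rfl, rfl⟩
    · rintro ⟨l, h, rfl, rfl⟩
      exact ⟨h, rfl⟩
  rw [hcount]
  obtain ⟨k, e, i⟩ := v
  obtain ⟨l, f, j⟩ := w
  rcases lt_trichotomy i j with h | rfl | h
  · by_cases hef : e = f
    · subst hef
      rw [(ncard_adj_eq_lt hx k h).1, adj_eq_lt h]
      simp [SparseArc, h, h.ne]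
    · simp only [(ncard_adj_ne_lt hx k hef h).1]
      simp only [SparseArc, hef, h.not_gt]
      simp
      omega
  · simp [SparseArc]
  · by_cases hef : e = f
    · subst hef
      simp only [(ncard_adj_eq_gt hx k h).1]
      simp only [SparseArc, h.not_gt]
      simp
      omega
    · rw [(ncard_adj_ne_gt hx k hef h).1, adj_ne_gt hef h]
      simp [SparseArc, h, h.ne', hef]

end Basic

/-! ### Rigidity of automorphisms -/

section Automorphisms

variable {H : Type u} [CommGroup H] {r : ℕ} {x : ℕ → H} {m : ℕ}

/-- Two vertices lie in the same layer iff some vertex is joined to neither of them. -/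
theorem layer_eq_iff (hx : IsIrredundant r x) {v w : LayeredVertex H m} :
    v.2.2 = w.2.2 ↔ ∃ z, (¬ (layeredDigraph r x m).Adj v z ∧ ¬ (layeredDigraph r x m).Adj z v) ∧
      ¬ (layeredDigraph r x m).Adj z w ∧ ¬ (layeredDigraph r x m).Adj w z := by
  have hne : ∀ e : Multiplicative (ZMod 2), ∃ f, e ≠ f := by decide
  have hloop : ∀ z, ¬ (layeredDigraph r x m).Adj z z :=
    fun z hz => isOriented_layeredDigraph hx z z hz hz
  constructor
  · intro h
    obtain ⟨k, e, i⟩ := v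
    obtain ⟨l, f, j⟩ := w
    obtain rfl : i = j := h
    -- Half-layers of one layer are not joined: any vertex of the opposite half serves in the first
    -- case, `w` itself in the second.
    by_cases hef : e = f
    · subst hef
      obtain ⟨f, hf⟩ := hne e
      refine ⟨(1, f, i), ⟨?_, ?_⟩, ?_, ?_⟩ <;>
        simp [layeredDigraph, SparseArc, hf, hf.symm]
    · refine ⟨(l, f, i), ⟨?_, ?_⟩, hloop _, hloop _⟩ <;>
        simp [layeredDigraph, SparseArc, hef, Ne.symm hef]
  · rintro ⟨z, ⟨h1, h2⟩, h3, h4⟩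
    have hvz : v.2.2 = z.2.2 := by
      by_contra h
      exact h1 ((layeredDigraph_adj_iff_not_adj h).2 h2)
    have hzw : z.2.2 = w.2.2 := by
      by_contra h
      exact h3 ((layeredDigraph_adj_iff_not_adj h).2 h4)
    exact hvz.trans hzw

variable {σ : Equiv.Perm (LayeredVertex H m)}

theorem aut_layer_eq_iff (hx : IsIrredundant r x) (hσ : σ ∈ digraphAut (layeredDigraph r x m))
    {v w : LayeredVertex H m} : (σ v).2.2 = (σ w).2.2 ↔ v.2.2 = w.2.2 := by
  rw [layer_eq_iff hx, layer_eq_iff hx, σ.surjective.exists]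
  simp only [hσ _ _]

/-- Arcs inside a layer stay in one half-layer, and the generators connect each half-layer. -/
theorem aut_snd_eq_of_snd_eq (hx : IsIrredundant r x)
    (hσ : σ ∈ digraphAut (layeredDigraph r x m)) {v w : LayeredVertex H m} (h : v.2 = w.2) :
    (σ v).2 = (σ w).2 := by
  have key : ∀ g : H, ∀ k q, (σ (k, q)).2 = (σ (k * g, q)).2 := by
    intro g
    have hg : g ∈ Subgroup.closure (x '' Set.Iio r) := hx.gen ▸ Subgroup.mem_top g
    induction hg using Subgroup.closure_induction with
    | mem g hg =>
      intro k q
      have hadj : (layeredDigraph r x m).Adj (k, q) (k * g, q) :=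
        adj_of_snd_eq.2 (by rwa [inv_mul_cancel_left])
      rw [← hσ, adj_of_layer_eq ((aut_layer_eq_iff hx hσ (v := (k, q)) (w := (k * g, q))).2 rfl)]
        at hadj
      exact hadj.1
    | one => simp
    | mul a b _ _ ha hb =>
      intro k q
      rw [ha k q, hb (k * a) q, mul_assoc]
    | inv a _ ha =>
      intro k q
      rw [ha (k * a⁻¹) q, inv_mul_cancel_right]
  obtain ⟨k, q⟩ := v
  obtain ⟨l, q'⟩ := w
  obtain rfl : q = q' := h
  simpa using key (k⁻¹ * l) k q

theorem aut_snd_eq_iff (hx : IsIrredundant r x)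
    (hσ : σ ∈ digraphAut (layeredDigraph r x m)) {v w : LayeredVertex H m} :
    (σ v).2 = (σ w).2 ↔ v.2 = w.2 := by
  refine ⟨fun h => ?_, aut_snd_eq_of_snd_eq hx hσ⟩
  simpa using aut_snd_eq_of_snd_eq hx (inv_mem hσ) h

/-- Sparse arcs out of `v` into the half-layer of `w` can be transported along arcs at `v`. -/
def IsTransportable {H : Type u} [CommGroup H] (r : ℕ) (x : ℕ → H) {m : ℕ}
    (v w : LayeredVertex H m) : Prop :=
  ∀ z, SparseArc r x v z → z.2 = w.2 → ∀ v', v'.2 = v.2 → (layeredDigraph r x m).Adj v v' →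
    ∃ w', SparseArc r x v' w' ∧ w'.2 = w.2 ∧ (layeredDigraph r x m).Adj z w'

/-- Within a coset, commutativity lets the same product be applied at `v'`. Across cosets, transport
along `x 0` would make some `x 0 * x b` a partial product, against `mul_ne_tailProd`. -/
theorem isTransportable_iff (hx : IsIrredundant r x) {v w : LayeredVertex H m}
    (h : SparseArc r x v w) : IsTransportable r x v w ↔ v.2.1 = w.2.1 := by
  obtain ⟨k, e, i⟩ := v
  obtain ⟨l, f, j⟩ := w
  constructor
  · intro ht
    by_contra hef
    obtain ⟨h1, -⟩ | ⟨-, hji, -⟩ := h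
    · exact hef h1
    obtain ⟨⟨l', q'⟩, hs, hq, hadj⟩ := ht (k⁻¹, f, j)
      (Or.inr ⟨hef, hji, 0, hx.pos, by simp [tailProd]⟩) rfl (k * x 0, e, i) rfl
      (adj_of_snd_eq.2 ⟨0, hx.pos, by simp⟩)
    obtain rfl : q' = (f, j) := hq
    obtain ⟨h1, -⟩ | ⟨-, -, a, ha, ha'⟩ := hs
    · exact hef h1
    obtain ⟨b, hb, hb'⟩ := adj_of_snd_eq.1 hadj
    refine hx.mul_ne_tailProd hb ha ?_
    simp only [inv_inv] at ha' hb'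
    rw [ha', hb', ← mul_assoc, mul_comm (x 0)]
  · rintro (rfl : e = f)
    obtain ⟨-, hij, -⟩ | ⟨h1, -⟩ := h
    · rintro ⟨l', q'⟩ hs (rfl : q' = (e, j)) ⟨k', q''⟩ (rfl : q'' = (e, i)) hadj
      obtain ⟨-, -, a, ha, ha'⟩ | ⟨h1, -⟩ := hs
      · obtain ⟨b, hb, hb'⟩ := adj_of_snd_eq.1 hadj
        refine ⟨(k' * tailProd x a, e, j), Or.inl ⟨rfl, hij, a, ha, by simp⟩, rfl,
          adj_of_snd_eq.2 ⟨b, hb, ?_⟩⟩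
        simp only at ha' hb'
        rw [hb', ha', eq_inv_mul_iff_mul_eq]
        calc l' * (k⁻¹ * k') = k' * (k⁻¹ * l') := by simp only [mul_comm, mul_left_comm]
          _ = _ := rfl
      · exact absurd rfl h1
    · exact absurd rfl h1

/-- Such an `f` is the shift by `f 0`, and the bound at `r - 1` forces `f 0 = 0`. -/
theorem path_rigid {r : ℕ} {f : ℕ → ℕ} (hf : ∀ k < r, f k < r)
    (hs : ∀ k, k + 1 < r → f (k + 1) = f k + 1) : ∀ k < r, f k = k := by
  have hadd : ∀ k < r, f k = f 0 + k := by
    intro k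
    induction k with
    | zero => simp
    | succ k ih =>
      intro hk
      rw [hs k hk, ih (by omega)]
      omega
  intro k hk
  have h1 := hadd (r - 1) (by omega)
  have h2 := hf (r - 1) (by omega)
  have h3 := hadd k hk
  omega

/-- The directed path formed by the sparse out-neighbours in a half-layer is fixed pointwise. -/
theorem mul_tailProd_of_path (hx : IsIrredundant r x)
    (hσ : σ ∈ digraphAut (layeredDigraph r x m)) {a b : H}
    {q : Multiplicative (ZMod 2) × Fin m}
    (h : ∀ k < r, ∃ l < r, σ (a * tailProd x k, q) = (b * tailProd x l, q)) :
    ∀ k < r, σ (a * tailProd x k, q) = (b * tailProd x k, q) := by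
  choose! f hf hf' using h
  have hid := path_rigid hf fun k hk => by
    have hadj : (layeredDigraph r x m).Adj (a * tailProd x k, q) (a * tailProd x (k + 1), q) :=
      adj_of_snd_eq.2 ⟨k + 1, hk, by rw [tailProd]; group⟩
    rw [← hσ, hf' k (by omega), hf' (k + 1) hk, adj_of_snd_eq] at hadj
    obtain ⟨j, hj, hj'⟩ := hadj
    refine hx.eq_succ_of_tailProd_mul hj (hf k (by omega)) (hf (k + 1) hk) ?_
    rw [hj']
    group
  intro k hk
  rw [hf' k hk, hid k hk]

variable [Finite H]

theorem aut_sparseArc_iff (hx : IsIrredundant r x)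
    (hσ : σ ∈ digraphAut (layeredDigraph r x m)) {v w : LayeredVertex H m} :
    SparseArc r x (σ v) (σ w) ↔ SparseArc r x v w := by
  rw [sparseArc_iff hx, sparseArc_iff hx, hσ, ne_eq, aut_layer_eq_iff hx hσ]
  have himg : {z | (layeredDigraph r x m).Adj (σ v) z ∧ z.2 = (σ w).2} =
      σ '' {z | (layeredDigraph r x m).Adj v z ∧ z.2 = w.2} := by
    ext z
    obtain ⟨z, rfl⟩ := σ.surjective z
    simp [hσ _ _, aut_snd_eq_iff hx hσ]
  rw [himg, Set.ncard_image_of_injective _ σ.injective]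

theorem aut_isTransportable (hx : IsIrredundant r x)
    (hσ : σ ∈ digraphAut (layeredDigraph r x m)) {v w : LayeredVertex H m}
    (h : IsTransportable r x v w) : IsTransportable r x (σ v) (σ w) := by
  intro z
  obtain ⟨z, rfl⟩ := σ.surjective z
  intro hs hq v'
  obtain ⟨v', rfl⟩ := σ.surjective v'
  rw [aut_sparseArc_iff hx hσ] at hs
  rw [aut_snd_eq_iff hx hσ] at hq ⊢
  intro hv' hadj
  obtain ⟨w', h1, h2, h3⟩ := h z hs hq v' hv' ((hσ _ _).1 hadj)
  exact ⟨σ w', (aut_sparseArc_iff hx hσ).2 h1, (aut_snd_eq_iff hx hσ).2 h2, (hσ _ _).2 h3⟩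

theorem aut_lt (hx : IsIrredundant r x) (hσ : σ ∈ digraphAut (layeredDigraph r x m))
    (k : H) (e : Multiplicative (ZMod 2)) {i j : Fin m} (hij : i < j) :
    (σ (k, e, i)).2.1 = (σ (k, e, j)).2.1 ∧ (σ (k, e, i)).2.2 < (σ (k, e, j)).2.2 := by
  have hs : SparseArc r x (k, e, i) (k, e, j) :=
    Or.inl ⟨rfl, hij, 0, hx.pos, by simp [tailProd]⟩
  have hs' := (aut_sparseArc_iff hx hσ).2 hs
  have he := (isTransportable_iff hx hs').1
    (aut_isTransportable hx hσ ((isTransportable_iff hx hs).2 rfl))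
  obtain ⟨-, h, -⟩ | ⟨h, -⟩ := hs'
  · exact ⟨he, h⟩
  · exact absurd he h

/-- Following one element of `H` through the layers gives a strictly increasing self-map of `Fin m`,
hence the identity. -/
theorem aut_layer (hx : IsIrredundant r x) (hσ : σ ∈ digraphAut (layeredDigraph r x m))
    (v : LayeredVertex H m) : (σ v).2.2 = v.2.2 := by
  obtain ⟨k, e, i⟩ := v
  have hmono : StrictMono fun i : Fin m => (σ (k, e, i)).2.2 :=
    fun i j hij => (aut_lt hx hσ k e hij).2
  exact congrFun (hmono.range_inj strictMono_id |>.1 (by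
    rw [(Finite.surjective_of_injective hmono.injective).range_eq, Set.range_id])) i

theorem eq_one_of_apply_eq_self (hx : IsIrredundant r x) (hm : 2 ≤ m)
    (hσ : σ ∈ digraphAut (layeredDigraph r x m))
    (h0 : σ (1, 1, ⟨0, by omega⟩) = (1, 1, ⟨0, by omega⟩)) : σ = 1 := by
  have hC : ∀ e f : Multiplicative (ZMod 2), e ≠ 1 → f ≠ 1 → e = f := by decide
  have hpos : 0 < r := hx.pos
  set i0 : Fin m := ⟨0, by omega⟩ with hi0
  set i1 : Fin m := ⟨1, by omega⟩ with hi1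
  have h01 : i0 < i1 := by simp [hi0, hi1, Fin.lt_def]
  have hmin : ∀ i, i0 = i ∨ i0 < i := fun i =>
    (Fin.le_def.2 (Nat.zero_le _) : i0 ≤ i).eq_or_lt
  have hone : ∀ k i, (σ (k, 1, i)).2.1 = 1 := by
    intro k i
    have h1 : (σ (k, 1, i0)).2.1 = 1 := by
      rw [aut_snd_eq_of_snd_eq hx hσ (v := (k, 1, i0)) (w := (1, 1, i0)) rfl, h0]
    rcases hmin i with rfl | h
    · exact h1
    · rw [← (aut_lt hx hσ k 1 h).1, h1]
  have hsnd : ∀ v, (σ v).2 = v.2 := by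
    rintro ⟨k, e, i⟩
    refine Prod.ext ?_ (aut_layer hx hσ _)
    by_cases he : e = 1
    · rw [he]; exact hone k i
    · refine hC _ _ (fun h => he ?_) he
      have : (σ (k, e, i)).2 = (σ (k, 1, i)).2 :=
        Prod.ext (h.trans (hone k i).symm)
          ((aut_layer hx hσ _).trans (aut_layer hx hσ (k, 1, i)).symm)
      exact congrArg Prod.fst ((aut_snd_eq_iff hx hσ).1 this)
  let T : Multiplicative (ZMod 2) × Fin m → H → H := fun q k => (σ (k, q)).1
  have hT : ∀ q k, σ (k, q) = (T q k, q) := fun q k => Prod.ext rfl (hsnd _)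
  -- Path rigidity determines the map on a half-layer from the one on a lower layer of the same
  -- coset.
  have hpar : ∀ e i j, i < j → ∀ g, ∀ k < r,
      T (e, j) (g * tailProd x k) = T (e, i) g * tailProd x k := by
    intro e i j hij g k hk
    refine congrArg Prod.fst (mul_tailProd_of_path hx hσ (q := (e, j)) (fun k hk => ?_) k hk)
    have hs : SparseArc r x (g, e, i) (g * tailProd x k, e, j) :=
      Or.inl ⟨rfl, hij, k, hk, by simp⟩
    rw [← aut_sparseArc_iff hx hσ, hT, hT] at hs
    obtain ⟨-, -, l, hl, hl'⟩ | ⟨h, -⟩ := hs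
    · refine ⟨l, hl, ?_⟩
      rw [hT, hl']
      simp
    · exact absurd rfl h
  have hanti : ∀ e f i j, e ≠ f → j < i → ∀ g, ∀ k < r,
      T (f, j) (g⁻¹ * tailProd x k) = (T (e, i) g)⁻¹ * tailProd x k := by
    intro e f i j hef hji g k hk
    refine congrArg Prod.fst (mul_tailProd_of_path hx hσ (q := (f, j)) (fun k hk => ?_) k hk)
    have hs : SparseArc r x (g, e, i) (g⁻¹ * tailProd x k, f, j) :=
      Or.inr ⟨hef, hji, k, hk, by simp⟩
    rw [← aut_sparseArc_iff hx hσ, hT, hT] at hs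
    obtain ⟨h, -⟩ | ⟨-, -, l, hl, hl'⟩ := hs
    · exact absurd h hef
    · refine ⟨l, hl, ?_⟩
      rw [hT, hl']
      simp
  have hindep : ∀ e i g, T (e, i) g = T (e, i0) g := by
    intro e i g
    rcases hmin i with rfl | h
    · rfl
    · simpa [tailProd] using hpar e i0 i h g 0 hpos
  -- Comparing with a second layer turns the link between layers into equivariance; this needs `2 ≤
  -- m`.
  have htail : ∀ e g, ∀ k < r, T (e, i0) (g * tailProd x k) = T (e, i0) g * tailProd x k := by
    intro e g k hk
    rw [← hpar e i0 i1 h01 g k hk, hindep e i1]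
  -- `x (k + 1)` is the quotient of two consecutive partial products.
  have hsucc : ∀ e g k, k + 1 < r → T (e, i0) (g * x (k + 1)) = T (e, i0) g * x (k + 1) := by
    intro e g k hk
    have h1 := htail e (g * (tailProd x k)⁻¹) (k + 1) hk
    have h2 := htail e (g * (tailProd x k)⁻¹) k (by omega)
    rw [inv_mul_cancel_right] at h2
    rw [h2, mul_assoc, ← tailProd, ← h1, tailProd]
    congr 1
    group
  have hgen : ∀ e g, ∀ k < r, T (e, i0) (g * x k) = T (e, i0) g * x k := by
    intro e g k hk
    have hadj : (layeredDigraph r x m).Adj (g, e, i0) (g * x k, e, i0) :=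
      adj_of_snd_eq.2 ⟨k, hk, by simp⟩
    rw [← hσ, hT, hT, adj_of_snd_eq] at hadj
    obtain ⟨j, hj, hj'⟩ := hadj
    have hj'' : T (e, i0) (g * x k) = T (e, i0) g * x j := by rw [hj']; group
    -- `x 0` occurs in no product. Its arc goes to an arc with some label `x j`; if `j ≠ 0`, that
    -- endpoint is already the image of `g * x j`, so injectivity decides.
    rcases k with _ | k
    · rcases j with _ | j
      · exact hj''
      · rw [← hsucc e g j hj] at hj''
        have : σ (g * x 0, e, i0) = σ (g * x (j + 1), e, i0) := by rw [hT, hT, hj'']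
        have := mul_left_cancel (congrArg Prod.fst (σ.injective this))
        rw [this]
        exact hsucc e g j hj
    · exact hsucc e g k hk
  have hmul : ∀ e g k, T (e, i0) (g * k) = T (e, i0) g * k := by
    intro e g k
    have hk : k ∈ Subgroup.closure (x '' Set.Iio r) := hx.gen ▸ Subgroup.mem_top k
    induction hk using Subgroup.closure_induction generalizing g with
    | mem k hk =>
      obtain ⟨j, hj, rfl⟩ := hk
      exact hgen e g j hj
    | one => simp
    | mul a b _ _ ha hb => rw [← mul_assoc, hb, ha, mul_assoc]
    | inv a _ ha =>
      have := ha (g * a⁻¹)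
      rw [inv_mul_cancel_right] at this
      rw [this, mul_inv_cancel_right]
  have hT1 : ∀ i k, T (1, i) k = k := by
    intro i k
    have h1 : T (1, i0) 1 = 1 := congrArg Prod.fst h0
    rw [hindep, ← one_mul k, hmul, h1]
  ext1 v
  obtain ⟨k, e, i⟩ := v
  rw [hT, Equiv.Perm.one_apply]
  congr 1
  by_cases he : e = 1
  · rw [he, hT1]
  -- A descending sparse arc carries triviality to the other coset.
  · have := hanti 1 e i1 i0 (Ne.symm he) h01 k⁻¹ 0 hpos
    rw [hT1] at this
    rw [hindep]
    simpa [tailProd] using this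

end Automorphisms

/-! ### The action of the generalized dihedral group -/

section Representation

variable {H : Type u} [CommGroup H] {r : ℕ} {x : ℕ → H} {m : ℕ}

/-- One factor is `h` and the other `h⁻¹`; hence arcs across cosets are defined by products, not
quotients. -/
theorem inversionAction_mul_of_ne {a b : Multiplicative (ZMod 2)} (hab : a ≠ b) (h : H) :
    inversionAction H a h * inversionAction H b h = 1 := by
  have key : ∀ a b : Multiplicative (ZMod 2), a ≠ b → a = 1 ∧ b ≠ 1 ∨ a ≠ 1 ∧ b = 1 := by decide
  rcases key a b hab with ⟨h1, h2⟩ | ⟨h1, h2⟩ <;> simp [inversionAction, h1, h2]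

/-- The semiregular action of the generalized dihedral group on the vertices: left multiplication
on each layer, the non-trivial coset of `H` being parametrized by inverses. -/
def layeredPerm (H : Type u) [CommGroup H] (m : ℕ) :
    GeneralizedDihedral H →* Equiv.Perm (LayeredVertex H m) :=
  MonoidHom.toHomPerm
    { toFun := fun g v =>
        (inversionAction H (g.right * v.2.1) g.left * v.1, g.right * v.2.1, v.2.2)
      map_one' := by
        funext v
        change (inversionAction H (1 * v.2.1) 1 * v.1, 1 * v.2.1, v.2.2) = v
        simp
      map_mul' := by
        have key : ∀ a b c : Multiplicative (ZMod 2), a * b * c * a = b * c := by decide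
        intro g g'
        funext v
        have h : inversionAction H (g.right * g'.right * v.2.1)
            (inversionAction H g.right g'.left) =
            inversionAction H (g'.right * v.2.1) g'.left := by
          rw [← MulAut.mul_apply, ← map_mul, key]
        change (inversionAction H (g.right * g'.right * v.2.1)
            (g.left * inversionAction H g.right g'.left) * v.1, g.right * g'.right * v.2.1, v.2.2) =
          (inversionAction H (g.right * (g'.right * v.2.1)) g.left *
            (inversionAction H (g'.right * v.2.1) g'.left * v.1),
            g.right * (g'.right * v.2.1), v.2.2)
        rw [map_mul (inversionAction H _), h, mul_assoc, mul_assoc g.right] }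

theorem layeredPerm_apply (g : GeneralizedDihedral H) (v : LayeredVertex H m) :
    layeredPerm H m g v =
      (inversionAction H (g.right * v.2.1) g.left * v.1, g.right * v.2.1, v.2.2) := rfl

theorem layeredPerm_mem (g : GeneralizedDihedral H) :
    layeredPerm H m g ∈ digraphAut (layeredDigraph r x m) := by
  rintro ⟨k, e, i⟩ ⟨l, f, j⟩
  by_cases hef : e = f
  · subst hef
    simp [layeredDigraph, SparseArc, layeredPerm_apply, mul_assoc, mul_left_comm]
  · have h1 : ∀ a b : H, inversionAction H (g.right * e) g.left * a *
        (inversionAction H (g.right * f) g.left * b) = a * b := by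
      intro a b
      rw [mul_mul_mul_comm, inversionAction_mul_of_ne (by simpa using hef), one_mul]
    have h2 : ∀ a b : H, inversionAction H (g.right * f) g.left * a *
        (inversionAction H (g.right * e) g.left * b) = a * b := by
      intro a b
      rw [mul_mul_mul_comm, inversionAction_mul_of_ne (by simpa using Ne.symm hef), one_mul]
    simp only [layeredDigraph, SparseArc, layeredPerm_apply, Prod.mk.injEq, ne_eq,
      mul_right_inj, hef, h1, h2, false_and, not_false_eq_true, true_and]

theorem eq_one_of_layeredPerm_apply_eq {g : GeneralizedDihedral H} {v : LayeredVertex H m}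
    (h : layeredPerm H m g v = v) : g = 1 := by
  rw [layeredPerm_apply] at h
  have hr : g.right = 1 := by simpa using congrArg (fun w => w.2.1) h
  have hl : g.left = 1 := by
    have := congrArg Prod.fst h
    simpa using this
  exact SemidirectProduct.ext hl hr

theorem exists_layeredPerm_apply_eq {v w : LayeredVertex H m} (h : v.2.2 = w.2.2) :
    ∃ g, layeredPerm H m g v = w := by
  refine ⟨⟨(inversionAction H w.2.1)⁻¹ (w.1 * v.1⁻¹), w.2.1 * v.2.1⁻¹⟩, ?_⟩
  rw [layeredPerm_apply]
  refine Prod.ext ?_ (Prod.ext ?_ h)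
  · simp
  · simp

theorem layeredPerm_injective (hm : 0 < m) : Function.Injective (layeredPerm H m) := by
  rw [injective_iff_map_eq_one]
  intro g hg
  exact eq_one_of_layeredPerm_apply_eq (v := (1, 1, ⟨0, hm⟩)) (by rw [hg]; rfl)

/-- Layers are preserved and the group is transitive on each, so an automorphism can be corrected to
fix a base vertex. -/
theorem digraphAut_layeredDigraph [Finite H] (hx : IsIrredundant r x) (hm : 2 ≤ m) :
    digraphAut (layeredDigraph r x m) = (layeredPerm H m).range := by
  refine le_antisymm (fun σ hσ => ?_) ?_
  · let v : LayeredVertex H m := (1, 1, ⟨0, by omega⟩)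
    obtain ⟨g, hg⟩ := exists_layeredPerm_apply_eq (aut_layer hx hσ v).symm
    refine ⟨g, ?_⟩
    have h1 := eq_one_of_apply_eq_self hx hm (mul_mem (inv_mem (layeredPerm_mem g)) hσ) (by
      change (layeredPerm H m g)⁻¹ (σ v) = v
      rw [← hg]
      exact Equiv.symm_apply_apply _ v)
    exact inv_mul_eq_one.1 h1
  · rintro _ ⟨g, rfl⟩
    exact layeredPerm_mem g

theorem card_orbits_layeredPerm :
    Nat.card (MulAction.orbitRel.Quotient (layeredPerm H m).range (LayeredVertex H m)) = m := by
  refine (Nat.card_congr (Equiv.ofBijective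
    (Quotient.lift (fun v : LayeredVertex H m => v.2.2) ?_) ⟨?_, ?_⟩)).trans (Nat.card_fin m)
  · rintro v w ⟨⟨_, g, rfl⟩, rfl⟩
    rfl
  · rintro ⟨v⟩ ⟨w⟩ h
    obtain ⟨g, hg⟩ := exists_layeredPerm_apply_eq (show w.2.2 = v.2.2 from h.symm)
    exact Quotient.sound ⟨⟨_, g, rfl⟩, hg⟩
  · intro i
    exact ⟨Quotient.mk _ (1, 1, i), rfl⟩

end Representation

/-! ### Conclusion -/

/-- If all squares were trivial, inversion would act trivially and the product would be direct and
abelian. -/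
theorem exists_mul_self_ne_one_of_not_comm {H : Type u} [CommGroup H]
    {a b : GeneralizedDihedral H} (hab : a * b ≠ b * a) : ∃ h : H, h * h ≠ 1 := by
  by_contra hcon
  push Not at hcon
  have hact : ∀ (c : Multiplicative (ZMod 2)) (h : H), inversionAction H c h = h := by
    intro c h
    by_cases hc : c = 1
    · simp [hc]
    · simp [inversionAction, hc, inv_eq_of_mul_eq_one_left (hcon h)]
  refine hab (SemidirectProduct.ext ?_ ?_)
  · simp [hact, mul_comm]
  · simp [mul_comm]

theorem lemma3p5 (G : Type u) [Group G] [Finite G] (hG : IsGeneralizedDihedral G)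
    (hna : ∃ a b : G, a * b ≠ b * a) (m : ℕ) (hm : 2 ≤ m) :
    AdmitsOmSR m G := by
  obtain ⟨H, _, ⟨φ⟩⟩ := hG
  have : Finite H := by
    have : Finite (GeneralizedDihedral H) := Finite.of_equiv G φ.toEquiv
    exact Finite.of_injective (SemidirectProduct.inl : H →* GeneralizedDihedral H)
      SemidirectProduct.inl_injective
  obtain ⟨a, b, hab⟩ := hna
  obtain ⟨h, hh⟩ := exists_mul_self_ne_one_of_not_comm (a := φ a) (b := φ b) (fun h =>
    hab (φ.injective (by rw [map_mul, map_mul, h])))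
  obtain ⟨r, x, hx⟩ := exists_isIrredundant hh
  have hiso : G ≃* (layeredPerm H m).range :=
    φ.trans (MonoidHom.ofInjective (layeredPerm_injective (by omega)))
  have haut := digraphAut_layeredDigraph hx hm
  refine ⟨LayeredVertex H m, inferInstance, ⟨(1, 1, ⟨0, by omega⟩)⟩, layeredDigraph r x m,
    isRegular_layeredDigraph hx, isOriented_layeredDigraph hx,
    ⟨(layeredPerm H m).range, haut.ge, ⟨hiso⟩, fun v => ?_, card_orbits_layeredPerm⟩,
    haut ▸ ⟨hiso⟩⟩
  rw [eq_bot_iff]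
  rintro ⟨_, g, rfl⟩ hg
  rw [Subgroup.mem_bot]
  obtain rfl := eq_one_of_layeredPerm_apply_eq
    (MulAction.mem_stabilizer_iff.1 hg : layeredPerm H m g v = v)
  exact Subtype.ext (map_one _)
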